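/- A \emph{chain graph} is a bipartite graph that does not contain an induced matching of size $2$. For a finite bipartite graph $G=(V,E)$, the \emph{minimum chain cover number} $\operatorname{ch}(G)$ is the smallest number of chain graphs on the vertex set $V$ such that the union of their edge sets is $E$ (so $\operatorname{ch}(G)=0$ if $E=\emptyset$). There is a polynomial-time approximation algorithm with factor $$\kappa(n)=2\left\lceil\frac{n\sqrt{\log\log n}}{\sqrt{\log n}}\right\rceil$$ for the minimum chain cover number of $n$-vertex bipartite graphs. That is, there are an algorithm and a polynomial $T$ such that, for every $n$ and every bipartite graph $G$ with vertex set $\{0,\dots,n-1\}$, given by $n$ and its adjacency matrix, the algorithm halts after at most $T(n)$ steps and, if $n\ge 3$, outputs a natural number $a$ with $$\operatorname{ch}(G)\le a\le \kappa(n)\cdot\operatorname{ch}(G).$$ Here $\log$ is the natural logarithm (for $n\ge 3$ the factor with binary logarithms is at least as large, so the statement holds for it as well). The algorithm is a program for a random access machine with registers and arrays of natural numbers, indirect addressing, and unit-cost addition, truncated subtraction and zero tests; polynomial time on this machine is the same as on Turing machines. -/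

import Mathlib

/-! ### Chain graphs and the minimum chain cover number -/

/-- A chain graph: a bipartite graph without an induced matching of size `2`. -/
def SimpleGraph.IsChainGraph {V : Type*} (H : SimpleGraph V) : Prop :=
  H.IsBipartite ∧ ¬ ∃ M : H.Subgraph, M.IsInduced ∧ M.IsMatching ∧ M.edgeSet.ncard = 2

/-- `C` is a cover of `G` by `k` chain graphs on the vertex set of `G`: the union of their
edge sets is the edge set of `G`. -/
def SimpleGraph.IsChainCover {V : Type*} (G : SimpleGraph V) {k : ℕ}
    (C : Fin k → SimpleGraph V) : Prop :=
  (∀ i, (C i).IsChainGraph) ∧ ⋃ i, (C i).edgeSet = G.edgeSet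

/-- The minimum chain cover number `ch(G)`. -/
noncomputable def SimpleGraph.chainCoverNumber {V : Type*} (G : SimpleGraph V) : ℕ :=
  sInf {k : ℕ | ∃ C : Fin k → SimpleGraph V, G.IsChainCover C}

/-- The approximation factor `2⌈n √(log log n) / √(log n)⌉`, with natural logarithms. For `3 ≤ n`
this is at most the same expression with binary logarithms. -/
noncomputable def chainCoverFactor (n : ℕ) : ℕ :=
  2 * ⌈(n : ℝ) * √(Real.log (Real.log n)) / √(Real.log n)⌉₊

/-! ### Random access machines

Programs over finitely many scalar registers and finitely many infinite arrays of natural numbers,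
with indirect addressing and structured control flow. The arithmetic is addition and truncated
subtraction (no multiplication), and every elementary operation costs one step, so that polynomial
time is the same as on Turing machines. -/

namespace RAM

/-- The content of the registers and of the arrays: `s.var x` is the register `x` and `s.arr a k` is
the cell `k` of the array `a`. -/
structure State where
  var : ℕ → ℕ
  arr : ℕ → ℕ → ℕ

/-- Expressions; `read a e` is the cell of the array `a` whose index is the value of `e`. -/
inductive Expr where
  | const (c : ℕ)
  | var (x : ℕ)
  | read (a : ℕ) (e : Expr)
  | add (e₁ e₂ : Expr)
  | sub (e₁ e₂ : Expr)

/-- The value of an expression. -/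
def Expr.eval (s : State) : Expr → ℕ
  | const c => c
  | var x => s.var x
  | read a e => s.arr a (e.eval s)
  | add e₁ e₂ => e₁.eval s + e₂.eval s
  | sub e₁ e₂ => e₁.eval s - e₂.eval s

/-- The number of steps it takes to evaluate an expression. -/
def Expr.cost : Expr → ℕ
  | const _ => 1
  | var _ => 1
  | read _ e => e.cost + 1
  | add e₁ e₂ => e₁.cost + e₂.cost + 1
  | sub e₁ e₂ => e₁.cost + e₂.cost + 1

/-- Programs. -/
inductive Prog where
  | skip
  /-- store the value of `e` in the register `x` -/
  | assign (x : ℕ) (e : Expr)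
  /-- store the value of `e` in the cell of the array `a` whose index is the value of `i` -/
  | write (a : ℕ) (i e : Expr)
  | seq (p q : Prog)
  /-- run `p` if the value of `e` is not `0`, and `q` otherwise -/
  | branch (e : Expr) (p q : Prog)
  /-- run `p` again and again as long as the value of `e` is not `0` -/
  | loop (e : Expr) (p : Prog)

/-- The state after storing `v` in the register `x`. -/
def State.setVar (s : State) (x v : ℕ) : State :=
  { s with var := Function.update s.var x v }

/-- The state after storing `v` in the cell `k` of the array `a`. -/
def State.setArr (s : State) (a k v : ℕ) : State :=
  { s with arr := Function.update s.arr a (Function.update (s.arr a) k v) }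

/-- `Exec p s t s'`: started in the state `s`, the program `p` halts after exactly `t` steps in the
state `s'`. -/
inductive Exec : Prog → State → ℕ → State → Prop
  | skip (s : State) : Exec .skip s 1 s
  | assign (x : ℕ) (e : Expr) (s : State) :
      Exec (.assign x e) s (e.cost + 1) (s.setVar x (e.eval s))
  | write (a : ℕ) (i e : Expr) (s : State) :
      Exec (.write a i e) s (i.cost + e.cost + 1) (s.setArr a (i.eval s) (e.eval s))
  | seq {p q : Prog} {s s' s'' : State} {t t' : ℕ} :
      Exec p s t s' → Exec q s' t' s'' → Exec (.seq p q) s (t + t') s''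
  | branch_true {e : Expr} {p q : Prog} {s s' : State} {t : ℕ} :
      e.eval s ≠ 0 → Exec p s t s' → Exec (.branch e p q) s (e.cost + 1 + t) s'
  | branch_false {e : Expr} {p q : Prog} {s s' : State} {t : ℕ} :
      e.eval s = 0 → Exec q s t s' → Exec (.branch e p q) s (e.cost + 1 + t) s'
  | loop_done {e : Expr} {p : Prog} {s : State} :
      e.eval s = 0 → Exec (.loop e p) s (e.cost + 1) s
  | loop_step {e : Expr} {p : Prog} {s s' s'' : State} {t t' : ℕ} :
      e.eval s ≠ 0 → Exec p s t s' → Exec (.loop e p) s' t' s'' →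
      Exec (.loop e p) s (e.cost + 1 + t + t') s''

/-- Programs are deterministic: the final state and the number of steps are determined by the
initial state. -/
theorem Exec.deterministic {p : Prog} {s s₁ s₂ : State} {t₁ t₂ : ℕ}
    (h₁ : Exec p s t₁ s₁) (h₂ : Exec p s t₂ s₂) : t₁ = t₂ ∧ s₁ = s₂ := by
  induction h₁ generalizing t₂ s₂ with
  | skip s => cases h₂; exact ⟨rfl, rfl⟩
  | assign x e s => cases h₂; exact ⟨rfl, rfl⟩
  | write a i e s => cases h₂; exact ⟨rfl, rfl⟩
  | seq _ _ ih ih' =>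
    cases h₂ with
    | seq k k' =>
      obtain ⟨rfl, rfl⟩ := ih k
      obtain ⟨rfl, rfl⟩ := ih' k'
      exact ⟨rfl, rfl⟩
  | branch_true he _ ih =>
    cases h₂ with
    | branch_true _ k => obtain ⟨rfl, rfl⟩ := ih k; exact ⟨rfl, rfl⟩
    | branch_false he' _ => exact absurd he' he
  | branch_false he _ ih =>
    cases h₂ with
    | branch_true he' _ => exact absurd he he'
    | branch_false _ k => obtain ⟨rfl, rfl⟩ := ih k; exact ⟨rfl, rfl⟩
  | loop_done he =>
    cases h₂ with
    | loop_done _ => exact ⟨rfl, rfl⟩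
    | loop_step he' _ _ => exact absurd he he'
  | loop_step he _ _ ih ih' =>
    cases h₂ with
    | loop_done he' => exact absurd he' he
    | loop_step _ k k' =>
      obtain ⟨rfl, rfl⟩ := ih k
      obtain ⟨rfl, rfl⟩ := ih' k'
      exact ⟨rfl, rfl⟩

open Classical in
/-- The initial state for the input `G`, a graph with the vertices `0, …, n - 1`: the register `0`
holds `n`, the cells `i * n + j` (`i, j < n`) of the array `0` hold the adjacency matrix of `G`, and
everything else is `0`. -/
noncomputable def initState {n : ℕ} (G : SimpleGraph (Fin n)) : State where
  var x := if x = 0 then n else 0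
  arr a k := if a = 0 ∧ ∃ i j : Fin n, k = (i : ℕ) * n + j ∧ G.Adj i j then 1 else 0

/-- The number that a program leaves behind as its output: the content of the register `0`. -/
def State.output (s : State) : ℕ := s.var 0

end RAM

/-!
In a chain graph the neighbourhoods of the vertices of a colour class are nested, so that ranking
the vertices by decreasing degree makes the neighbours of a vertex neighbours of all vertices of its
class that rank below it. A cover by `ch(G)` chain graphs therefore yields two rankings of any set
`B` of vertices per chain graph, one for each colour class, that explain all edges that meet `B`.
Conversely, every ranking of `B` determines a chain graph contained in `G` (`initialGraph`). For `B`
with `k` vertices, where `k` is about `√(log n / log log n)`, there are only `k ^ (k * k)` lists of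
`k` rankings, which is polynomial in `n`, so that an optimal list is found by exhaustive search. At
most `⌈n √(log log n) / √(log n)⌉` such blocks `B` partition the vertices, and each contributes at
most `2 ch(G)` chain graphs to the union of the optimal covers.

On the machine, the functions computable in polynomial time with polynomially bounded values are
closed under composition and under recursion with polynomially bounded values, hence also under
bounded sums, bounded quantifiers and bounded minimization, from which the search is composed.
-/

namespace ChainCover

open SimpleGraph

variable {V ι β : Type*} {G H : SimpleGraph V}

/-! ### Induced matchings of size two -/

theorem eq_of_adj_of_isInduced_of_isMatching {M : H.Subgraph} (hind : M.IsInduced)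
    (hmat : M.IsMatching) {u v u' v' : V} (h : M.Adj u v) (h' : M.Adj u' v')
    (hadj : H.Adj u u') : s(u, v) = s(u', v') := by
  have hM : M.Adj u u' := hind h.fst_mem h'.fst_mem hadj
  obtain rfl : v = u' := (hmat h.fst_mem).unique h hM
  obtain rfl : u = v' := (hmat h'.fst_mem).unique hM.symm h'
  exact Sym2.eq_swap

theorem exists_inducedMatching_two_iff :
    (∃ M : H.Subgraph, M.IsInduced ∧ M.IsMatching ∧ M.edgeSet.ncard = 2) ↔
      ∃ u v u' v', H.Adj u v ∧ H.Adj u' v' ∧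
        ¬ H.Adj u u' ∧ ¬ H.Adj u v' ∧ ¬ H.Adj v u' ∧ ¬ H.Adj v v' := by
  constructor
  · rintro ⟨M, hind, hmat, hcard⟩
    obtain ⟨e, e', hne, heq⟩ := Set.ncard_eq_two.1 hcard
    have he : e ∈ M.edgeSet := heq ▸ Set.mem_insert e {e'}
    have he' : e' ∈ M.edgeSet := heq ▸ Set.mem_insert_of_mem e rfl
    induction e with | _ u v
    induction e' with | _ u' v'
    have key {a b c d : V} (h : M.Adj a b) (h' : M.Adj c d) :=
      eq_of_adj_of_isInduced_of_isMatching hind hmat h h'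
    refine ⟨u, v, u', v', he.adj_sub, he'.adj_sub, fun h => hne (key he he' h), fun h => hne ?_,
      fun h => hne ?_, fun h => hne ?_⟩
    · exact (key he he'.symm h).trans Sym2.eq_swap
    · exact Sym2.eq_swap.trans (key he.symm he' h)
    · exact Sym2.eq_swap.trans ((key he.symm he'.symm h).trans Sym2.eq_swap)
  · rintro ⟨u, v, u', v', h, h', huu', huv', hvu', hvv'⟩
    have hne_uu' : u ≠ u' := by rintro rfl; exact huv' h'
    have hne_uv' : u ≠ v' := by rintro rfl; exact huu' h'.symm
    have hne_vu' : v ≠ u' := by rintro rfl; exact hvv' h'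
    have hne_vv' : v ≠ v' := by rintro rfl; exact hvu' h'.symm
    refine ⟨H.subgraphOfAdj h ⊔ H.subgraphOfAdj h', fun a ha b hb hab => ?_,
      (Subgraph.IsMatching.subgraphOfAdj h).sup (Subgraph.IsMatching.subgraphOfAdj h') ?_, ?_⟩
    · simp only [Subgraph.verts_sup, subgraphOfAdj_verts, Set.mem_union, Set.mem_insert_iff,
        Set.mem_singleton_iff] at ha hb
      simp only [Subgraph.sup_adj, subgraphOfAdj_adj, Sym2.eq_iff]
      grind [SimpleGraph.adj_comm, SimpleGraph.irrefl]
    · simp only [support_subgraphOfAdj, Set.disjoint_insert_left, Set.disjoint_singleton_left,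
        Set.mem_insert_iff, Set.mem_singleton_iff]
      tauto
    · rw [Subgraph.edgeSet_sup, edgeSet_subgraphOfAdj, edgeSet_subgraphOfAdj, Set.singleton_union,
        Set.ncard_pair]
      simp [hne_uu', hne_uv']

theorem neighborSet_subset_or_subset (hH : H.IsChainGraph) (col : H.Coloring (Fin 2)) {u u' : V}
    (h : col u = col u') :
    H.neighborSet u ⊆ H.neighborSet u' ∨ H.neighborSet u' ⊆ H.neighborSet u := by
  by_contra! hnot
  obtain ⟨⟨v, huv, hu'v⟩, ⟨v', hu'v', huv'⟩⟩ :=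
    hnot.imp Set.not_subset.1 Set.not_subset.1
  rw [mem_neighborSet] at huv hu'v hu'v' huv'
  have hvv' : col v = col v' := by
    have := col.valid huv
    have := col.valid hu'v'
    omega
  exact hH.2 (exists_inducedMatching_two_iff.2 ⟨u, v, u', v', huv, hu'v',
    fun hadj => col.valid hadj h, huv', fun hadj => hu'v hadj.symm,
    fun hadj => col.valid hadj hvv'⟩)

theorem isChainCover_adj_iff {k : ℕ} {C : Fin k → SimpleGraph V} (hC : G.IsChainCover C) {u v : V} :
    G.Adj u v ↔ ∃ i, (C i).Adj u v := by
  rw [← mem_edgeSet, ← hC.2, Set.mem_iUnion]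
  rfl

theorem exists_isChainCover [Fintype ι] {C : ι → SimpleGraph V} (h : ∀ i, (C i).IsChainGraph)
    (hC : ∀ u v, G.Adj u v ↔ ∃ i, (C i).Adj u v) :
    ∃ D : Fin (Fintype.card ι) → SimpleGraph V, G.IsChainCover D := by
  refine ⟨fun i => C ((Fintype.equivFin ι).symm i), fun i => h _, ?_⟩
  ext e
  induction e with | _ u v
  rw [Set.mem_iUnion, mem_edgeSet, hC]
  exact ((Fintype.equivFin ι).symm.surjective.exists (p := fun i => (C i).Adj u v)).symm

/-! ### Rankings and chain graphs -/

section Rankings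

variable [LinearOrder β] {B : Set V}

/-- The vertex `v` is adjacent to `u ∈ B` and to all vertices of `B` that the ranking `r` does not
place above `u`. Such pairs are the edges of a chain graph: the larger the rank of `u`, the fewer
such `v` there are. -/
def InitialAdj (G : SimpleGraph V) (B : Set V) (r : V → β) (u v : V) : Prop :=
  u ∈ B ∧ ∀ w ∈ B, r w ≤ r u → G.Adj w v

/-- The graph of the edges given by `InitialAdj`. -/
def initialGraph (G : SimpleGraph V) (B : Set V) (r : V → β) : SimpleGraph V :=
  .fromRel (InitialAdj G B r)

theorem InitialAdj.adj {r : V → β} {u v : V} (h : InitialAdj G B r u v) : G.Adj u v :=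
  h.2 u h.1 le_rfl

theorem initialGraph_adj {r : V → β} {u v : V} :
    (initialGraph G B r).Adj u v ↔ InitialAdj G B r u v ∨ InitialAdj G B r v u :=
  (fromRel_adj ..).trans (and_iff_right_of_imp fun h => h.elim (·.adj.ne) (·.adj.ne'))

theorem initialGraph_le (G : SimpleGraph V) (B : Set V) (r : V → β) : initialGraph G B r ≤ G := by
  intro u v h
  exact (initialGraph_adj.1 h).elim (·.adj) (·.adj.symm)

theorem initialAdj_or_initialAdj {r : V → β} {u v u' v' : V} (h : InitialAdj G B r u v)
    (h' : InitialAdj G B r u' v') : InitialAdj G B r u' v ∨ InitialAdj G B r u v' :=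
  (le_total (r u') (r u)).imp (fun hle => ⟨h'.1, fun w hw hwu => h.2 w hw (hwu.trans hle)⟩)
    fun hle => ⟨h.1, fun w hw hwu => h'.2 w hw (hwu.trans hle)⟩

theorem isChainGraph_initialGraph (hG : G.IsBipartite) (B : Set V) (r : V → β) :
    (initialGraph G B r).IsChainGraph := by
  refine ⟨Colorable.mono_left (initialGraph_le G B r) hG, ?_⟩
  rw [exists_inducedMatching_two_iff]
  rintro ⟨u, v, u', v', h, h', huu', huv', hvu', hvv'⟩
  simp only [initialGraph_adj, not_or] at h h' huu' huv' hvu' hvv'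
  rcases h with h | h <;> rcases h' with h' | h' <;>
    rcases initialAdj_or_initialAdj h h' with h'' | h'' <;> tauto

/-- The rankings `r i` of `B` cover the edges that meet `B`. -/
def IsRankCover (G : SimpleGraph V) (B : Set V) (r : ι → V → β) : Prop :=
  ∀ u ∈ B, ∀ v, G.Adj u v → ∃ i, InitialAdj G B (r i) u v

theorem isRankCover_of_injOn {f : V → ι} [DecidableEq ι] (hf : B.InjOn f) :
    IsRankCover G B fun i w => if f w = i then 0 else 1 := by
  refine fun u hu v huv => ⟨f u, hu, fun w hw hwu => ?_⟩
  have hfw : f w = f u := by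
    by_contra hne
    simp [hne] at hwu
  rwa [hf hw hu hfw]

theorem isRankCover_of_isChainCover [Finite V] {h : ℕ} {C : Fin h → SimpleGraph V}
    (hC : G.IsChainCover C) (col : G.Coloring (Fin 2)) (B : Set V) :
    IsRankCover G B fun (i : Fin h × Fin 2) u =>
      if col u = i.2 then ((C i.1).neighborSet u)ᶜ.encard else ⊤ := by
  intro u hu v huv
  obtain ⟨i, hi⟩ := (isChainCover_adj_iff hC).1 huv
  refine ⟨(i, col u), hu, fun w _ hwu => (isChainCover_adj_iff hC).2 ⟨i, ?_⟩⟩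
  have hfin := Set.encard_ne_top_iff.2 ((C i).neighborSet u)ᶜ.toFinite
  have hcol : col w = col u := by
    by_contra hne
    simp [hne, hfin] at hwu
  simp only [hcol, if_true] at hwu
  have hle : C i ≤ G := fun a b hab => (isChainCover_adj_iff hC).2 ⟨i, hab⟩
  suffices (C i).neighborSet u ⊆ (C i).neighborSet w from this hi
  refine (neighborSet_subset_or_subset (hC.1 i) (col.comp (.ofLE hle)) hcol).elim
    (fun hsub => ?_) id
  have hcompl := (Set.toFinite _).eq_of_subset_of_encard_le (Set.compl_subset_compl.2 hsub) hwu
  exact (compl_injective hcompl).subset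

/-- The position of `u` in the ranking `r` of `B`. -/
noncomputable def rankIn (B : Set V) (r : V → β) (u : V) : ℕ := {b ∈ B | r b < r u}.ncard

theorem rankIn_lt_ncard [Finite V] {r : V → β} {u : V} (hu : u ∈ B) : rankIn B r u < B.ncard :=
  Set.ncard_lt_ncard ⟨fun _ hb => hb.1, fun hsub => lt_irrefl _ (hsub hu).2⟩

theorem rankIn_lt_rankIn [Finite V] {r : V → β} {u w : V} (hu : u ∈ B) (h : r u < r w) :
    rankIn B r u < rankIn B r w :=
  Set.ncard_lt_ncard ⟨fun _ hb => ⟨hb.1, hb.2.trans h⟩, fun hsub => lt_irrefl _ (hsub ⟨hu, h⟩).2⟩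

theorem exists_isChainCover_of_isRankCover {κ : Type*} [Fintype κ] (hG : G.IsBipartite)
    {B : κ → Set V} (hB : ∀ u, ∃ q, u ∈ B q) {c : κ → ℕ} {r : ∀ q, Fin (c q) → V → β}
    (hr : ∀ q, IsRankCover G (B q) (r q)) :
    ∃ C : Fin (∑ q, c q) → SimpleGraph V, G.IsChainCover C := by
  have hcover := exists_isChainCover (G := G)
    (C := fun i : Σ q, Fin (c q) => initialGraph G (B i.1) (r i.1 i.2))
    (fun i => isChainGraph_initialGraph hG _ _)
    fun u v => ⟨fun huv => ?_, fun ⟨_, hi⟩ => initialGraph_le _ _ _ hi⟩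
  · rwa [Fintype.card_sigma, Finset.sum_congr rfl fun _ _ => Fintype.card_fin _] at hcover
  · obtain ⟨q, hq⟩ := hB u
    obtain ⟨j, hj⟩ := hr q u hq v huv
    exact ⟨⟨q, j⟩, initialGraph_adj.2 (.inl hj)⟩

end Rankings

/-! ### Optimal rankings of blocks -/

section Blocks

variable {n k q c : ℕ} {G : SimpleGraph (Fin n)}

/-- The block `q` in the partition of the vertices into blocks of `k` consecutive vertices. -/
def block (n k q : ℕ) : Set (Fin n) := {u | (u : ℕ) / k = q}

theorem injOn_mod_block (n k q : ℕ) : (block n k q).InjOn fun u : Fin n => (u : ℕ) % k := by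
  intro u hu v hv h
  have hdiv : (u : ℕ) / k = v / k := Eq.trans hu (Eq.symm hv)
  rw [Fin.ext_iff, ← Nat.div_add_mod u k, ← Nat.div_add_mod v k, hdiv]
  exact congrArg (k * (v / k) + ·) h

theorem ncard_block_le (hk : 0 < k) : (block n k q).ncard ≤ k := by
  have hle := Set.ncard_le_ncard_of_injOn (t := Set.Iio k) _
    (fun (u : Fin n) _ => Nat.mod_lt (u : ℕ) hk) (injOn_mod_block n k q) (Set.finite_Iio k)
  rwa [← Finset.coe_Iio, Set.ncard_coe_finset, Nat.card_Iio] at hle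

theorem block_eq_empty (h : n ≤ q * k) : block n k q = ∅ := by
  refine Set.eq_empty_of_forall_notMem fun u hu => ?_
  have hlt : (u : ℕ) / k < q := Nat.div_lt_of_lt_mul (by rw [mul_comm]; exact u.2.trans_le h)
  exact hlt.ne hu

/-- The rank of the vertex `w` in the ranking `j` that the base-`k` digits of `x` encode. Distinct
vertices of a block have distinct residues modulo `k`, so a block can be ranked arbitrarily. -/
def rank (k x j w : ℕ) : ℕ := x / k ^ (w % k + k * j) % k

theorem exists_digit_eq {ι : Type*} {N : ℕ} {e g : ι → ℕ} (hk : 0 < k) (he : e.Injective)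
    (hN : ∀ i, e i < N) (hg : ∀ i, g i < k) : ∃ x < k ^ N, ∀ i, x / k ^ e i % k = g i := by
  let d (m : Fin N) : Fin k := ⟨Function.extend e g 0 m % k, Nat.mod_lt _ hk⟩
  refine ⟨finFunctionFinEquiv d, Fin.is_lt _, fun i => ?_⟩
  have hdigit := finFunctionFinEquiv_symm_apply_val (finFunctionFinEquiv d) ⟨e i, hN i⟩
  rw [Equiv.symm_apply_apply] at hdigit
  simpa only [d, he.extend_apply, Nat.mod_eq_of_lt (hg i)] using hdigit.symm

theorem exists_rank_eq (hk : 0 < k) (hc : c ≤ k) {g : Fin c → Fin n → ℕ}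
    (hg : ∀ j, ∀ w ∈ block n k q, g j w < k) :
    ∃ x < k ^ (k * k), ∀ j : Fin c, ∀ w ∈ block n k q, rank k x j w = g j w := by
  let position (p : Fin c × block n k q) : ℕ := (p.2 : ℕ) % k + k * p.1
  have hinj : position.Injective := by
    rintro ⟨i, u, hu⟩ ⟨j, v, hv⟩ h
    have hmod : (u : ℕ) % k = v % k := by simpa [position] using congrArg (· % k) h
    obtain rfl := injOn_mod_block n k q hu hv hmod
    obtain rfl : i = j := Fin.ext (Nat.eq_of_mul_eq_mul_left hk (Nat.add_left_cancel h))
    rfl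
  have hlt (p) : position p < k * k := by
    have hindex := Nat.mul_le_mul_left k (p.1.2.trans_le hc)
    rw [Nat.mul_succ] at hindex
    exact (Nat.add_lt_add_right (Nat.mod_lt _ hk) _).trans_le ((add_comm ..).trans_le hindex)
  obtain ⟨x, hx, hrank⟩ := exists_digit_eq (g := fun p => g p.1 p.2) hk hinj hlt
    fun p => hg p.1 p.2 p.2.2
  exact ⟨x, hx, fun j w hw => hrank (j, ⟨w, hw⟩)⟩

/-- Some `c` rankings, encoded by a number below `k ^ (k * k)`, cover the edges that meet the
block `q`. -/
def Coverable (G : SimpleGraph (Fin n)) (k q c : ℕ) : Prop :=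
  ∃ x < k ^ (k * k), IsRankCover G (block n k q) fun (j : Fin c) w => rank k x j w

theorem coverable_of_isRankCover {ι β : Type*} [Fintype ι] [LinearOrder β] {r : ι → Fin n → β}
    (hk : 0 < k) (hι : Fintype.card ι ≤ k) (hr : IsRankCover G (block n k q) r) :
    Coverable G k q (Fintype.card ι) := by
  let e := Fintype.equivFin ι
  obtain ⟨x, hx, hrank⟩ := exists_rank_eq (q := q) hk hι
    (g := fun j => rankIn (block n k q) (r (e.symm j)))
    fun j w hw => (rankIn_lt_ncard hw).trans_le (ncard_block_le hk)
  refine ⟨x, hx, fun u hu v huv => ?_⟩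
  obtain ⟨i, hi⟩ := hr u hu v huv
  refine ⟨e i, hu, fun w hw hle => hi.2 w hw (le_of_not_gt fun hwu => ?_)⟩
  simp only [hrank _ w hw, hrank _ u hu, e.symm_apply_apply] at hle
  exact (rankIn_lt_rankIn hu hwu).not_ge hle

theorem coverable_self (G : SimpleGraph (Fin n)) (hk : 0 < k) (q : ℕ) : Coverable G k q k := by
  have hinj : (block n k q).InjOn fun u : Fin n => (⟨u % k, Nat.mod_lt _ hk⟩ : Fin k) :=
    fun u hu v hv h => injOn_mod_block n k q hu hv (Fin.val_eq_of_eq h)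
  have hcover := coverable_of_isRankCover (β := ℕ) hk (Fintype.card_fin k).le
    (isRankCover_of_injOn (G := G) hinj)
  rwa [Fintype.card_fin] at hcover

/-- The smallest number of rankings that cover the edges that meet the block `q`. -/
noncomputable def blockCoverNumber (G : SimpleGraph (Fin n)) (k q : ℕ) : ℕ :=
  sInf {c | Coverable G k q c}

theorem coverable_blockCoverNumber (G : SimpleGraph (Fin n)) (hk : 0 < k) (q : ℕ) :
    Coverable G k q (blockCoverNumber G k q) :=
  Nat.sInf_mem (s := {c | Coverable G k q c}) ⟨k, coverable_self G hk q⟩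

theorem blockCoverNumber_eq_zero (hk : 0 < k) (h : n ≤ q * k) : blockCoverNumber G k q = 0 :=
  Nat.sInf_eq_zero.2 <| .inl ⟨0, Nat.pow_pos hk, fun u hu => by
    rw [block_eq_empty h] at hu
    exact hu.elim⟩

theorem exists_isChainCover_sum_blockCoverNumber (hG : G.IsBipartite) (hk : 0 < k) :
    ∃ C : Fin (∑ q ∈ Finset.range n, blockCoverNumber G k q) → SimpleGraph (Fin n),
      G.IsChainCover C := by
  choose x _ hx using coverable_blockCoverNumber G hk
  rw [Finset.sum_range]
  exact exists_isChainCover_of_isRankCover hG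
    (fun u => ⟨⟨u / k, (Nat.div_le_self _ _).trans_lt u.2⟩, rfl⟩) fun q => hx q

theorem blockCoverNumber_le (hG : G.IsBipartite) (hk : 0 < k) :
    blockCoverNumber G k q ≤ 2 * G.chainCoverNumber := by
  rcases le_total (2 * G.chainCoverNumber) k with h | h
  · obtain ⟨C, hC⟩ := Nat.sInf_mem (s := {k | ∃ C : Fin k → SimpleGraph (Fin n), G.IsChainCover C})
      ⟨_, exists_isChainCover_sum_blockCoverNumber hG hk⟩
    obtain ⟨col⟩ := hG
    have hcard : Fintype.card (Fin G.chainCoverNumber × Fin 2) = 2 * G.chainCoverNumber := by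
      rw [Fintype.card_prod, Fintype.card_fin, Fintype.card_fin, mul_comm]
    have hcover := coverable_of_isRankCover hk (hcard.trans_le h)
      (isRankCover_of_isChainCover hC col (block n k q))
    exact Nat.sInf_le (hcard ▸ hcover)
  · exact (Nat.sInf_le (coverable_self G hk q)).trans h

theorem sum_blockCoverNumber_le (hG : G.IsBipartite) (hk : 0 < k) {M : ℕ} (hM : n ≤ M * k) :
    ∑ q ∈ Finset.range n, blockCoverNumber G k q ≤ M * (2 * G.chainCoverNumber) := by
  calc ∑ q ∈ Finset.range n, blockCoverNumber G k q
      ≤ ∑ q ∈ Finset.range M, blockCoverNumber G k q := by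
        refine Finset.sum_le_sum_of_ne_zero fun q _ hq => Finset.mem_range.2 ?_
        by_contra! hMq
        exact hq (blockCoverNumber_eq_zero hk (hM.trans (Nat.mul_le_mul_right k hMq)))
    _ ≤ (Finset.range M).card • (2 * G.chainCoverNumber) :=
        Finset.sum_le_card_nsmul _ _ _ fun _ _ => blockCoverNumber_le hG hk
    _ = M * (2 * G.chainCoverNumber) := by rw [Finset.card_range, smul_eq_mul]

end Blocks

/-! ### The size of the blocks -/

/-- The smallest `k` with `n ≤ k ^ (k * k)`, which is of order `√(log n / log log n)`. -/
noncomputable def blockBase (n : ℕ) : ℕ := sInf {k | n ≤ k ^ (k * k)}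

theorem le_self_pow_mul_self (n : ℕ) : n ≤ n ^ (n * n) := by
  rcases n.eq_zero_or_pos with rfl | hn
  · exact Nat.zero_le _
  · exact Nat.le_self_pow (Nat.mul_pos hn hn).ne' n

theorem le_blockBase_pow (n : ℕ) : n ≤ blockBase n ^ (blockBase n * blockBase n) :=
  Nat.sInf_mem (s := {k | n ≤ k ^ (k * k)}) ⟨n, le_self_pow_mul_self n⟩

theorem pow_lt_of_lt_blockBase {n k : ℕ} (hk : k < blockBase n) : k ^ (k * k) < n :=
  not_le.1 (Nat.notMem_of_lt_sInf (s := {k | n ≤ k ^ (k * k)}) hk)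

/-- The number of vertices of a block. An exhaustive search over `k ^ (k * k)` candidates remains
polynomial for this `k`, and the summand `4` makes `log_le_blockSize_sq_mul` true for small `n`. -/
noncomputable def blockSize (n : ℕ) : ℕ := blockBase n + 4

theorem blockSize_pos (n : ℕ) : 0 < blockSize n := Nat.succ_pos _

theorem blockSize_pow_le (n : ℕ) : blockSize n ^ (blockSize n * blockSize n) ≤ (n + 2) ^ 108 := by
  rcases le_or_gt (blockSize n) 6 with h | h
  · calc blockSize n ^ (blockSize n * blockSize n)
        ≤ 6 ^ (6 * 6) := pow_le_pow h (by norm_num) (Nat.mul_le_mul h h)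
      _ ≤ 2 ^ 108 := by norm_num
      _ ≤ (n + 2) ^ 108 := Nat.pow_le_pow_left (Nat.le_add_left 2 n) _
  · obtain ⟨i, hi⟩ : ∃ i, blockSize n = i + 5 := ⟨blockSize n - 5, by omega⟩
    have hi2 : 2 ≤ i := by omega
    have hlt : i ^ (i * i) < n :=
      pow_lt_of_lt_blockBase (lt_of_lt_of_eq i.lt_succ_self (Nat.add_right_cancel hi).symm)
    have hbase : i + 5 ≤ i ^ 3 := by nlinarith [Nat.pow_le_pow_left hi2 2]
    have hexp : (i + 5) * (i + 5) ≤ 13 * (i * i) := by nlinarith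
    calc blockSize n ^ (blockSize n * blockSize n)
        = (i + 5) ^ ((i + 5) * (i + 5)) := by rw [hi]
      _ ≤ (i ^ 3) ^ (13 * (i * i)) := pow_le_pow hbase (Nat.one_le_pow _ _ (by omega)) hexp
      _ = (i ^ (i * i)) ^ 39 := by rw [← pow_mul, ← pow_mul]; congr 1; ring
      _ ≤ (n + 2) ^ 39 := Nat.pow_le_pow_left (by omega) _
      _ ≤ (n + 2) ^ 108 := Nat.pow_le_pow_right (by omega) (by norm_num)

theorem one_div_sixteen_le_log_log {n : ℕ} (hn : 3 ≤ n) : 1 / 16 ≤ Real.log (Real.log n) := by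
  have hlog3 : 16 / 15 ≤ Real.log n :=
    (by norm_num : (16 / 15 : ℝ) ≤ 1.0986122885).trans <|
      Real.log_three_gt_d9.le.trans (Real.log_le_log (by norm_num) (Nat.ofNat_le_cast.2 hn))
  have hinv : (Real.log n)⁻¹ ≤ (16 / 15)⁻¹ := inv_anti₀ (by norm_num) hlog3
  have hloglog := Real.one_sub_inv_le_log_of_pos (x := Real.log n) (by linarith)
  norm_num at hinv
  linarith

theorem log_le_blockSize_sq_mul {n : ℕ} (hn : 3 ≤ n) :
    Real.log n ≤ blockSize n ^ 2 * Real.log (Real.log n) := by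
  have hnk := le_blockBase_pow n
  have hblock : (blockSize n : ℝ) = blockBase n + 4 := Nat.cast_add ..
  rw [hblock]
  set k := blockBase n
  have hk0 : 0 < k := by
    refine Nat.pos_of_ne_zero fun h => ?_
    rw [h, mul_zero, pow_zero] at hnk
    omega
  have hloglog := one_div_sixteen_le_log_log hn
  rcases le_total (Real.log k) (Real.log (Real.log n)) with h | h
  · have hlog := Real.log_le_log (by positivity) (Nat.cast_le (α := ℝ).2 hnk)
    rw [Nat.cast_pow, Real.log_pow, Nat.cast_mul] at hlog
    calc Real.log n ≤ k * k * Real.log k := hlog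
      _ ≤ k * k * Real.log (Real.log n) := by gcongr
      _ ≤ (k + 4) ^ 2 * Real.log (Real.log n) := by gcongr; nlinarith
  · have hlog : 0 < Real.log n := Real.log_pos (by norm_cast; omega)
    calc Real.log n ≤ k := (Real.log_le_log_iff hlog (Nat.cast_pos.2 hk0)).1 h
      _ ≤ (k + 4) ^ 2 * (1 / 16) := by nlinarith [sq_nonneg ((k : ℝ) - 4)]
      _ ≤ (k + 4) ^ 2 * Real.log (Real.log n) := by gcongr

theorem le_ceil_mul_blockSize {n : ℕ} (hn : 3 ≤ n) :
    n ≤ ⌈(n : ℝ) * √(Real.log (Real.log n)) / √(Real.log n)⌉₊ * blockSize n := by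
  have hlog : 0 < √(Real.log n) := Real.sqrt_pos.2 (Real.log_pos (by norm_cast; omega))
  have hsqrt : √(Real.log n) ≤ blockSize n * √(Real.log (Real.log n)) := by
    have h := Real.sqrt_le_sqrt (log_le_blockSize_sq_mul hn)
    rwa [Real.sqrt_mul (by positivity), Real.sqrt_sq (by positivity)] at h
  refine Nat.cast_le (α := ℝ).1 ?_
  calc (n : ℝ) = n * √(Real.log n) / √(Real.log n) := by field_simp
    _ ≤ n * (blockSize n * √(Real.log (Real.log n))) / √(Real.log n) := by gcongr
    _ = n * √(Real.log (Real.log n)) / √(Real.log n) * blockSize n := by ring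
    _ ≤ ⌈(n : ℝ) * √(Real.log (Real.log n)) / √(Real.log n)⌉₊ * blockSize n := by
        gcongr
        exact Nat.le_ceil _
    _ = _ := by norm_cast

/-- The output of the algorithm. -/
noncomputable def chainCoverEstimate {n : ℕ} (G : SimpleGraph (Fin n)) : ℕ :=
  ∑ q ∈ Finset.range n, blockCoverNumber G (blockSize n) q

theorem chainCoverNumber_le_chainCoverEstimate {n : ℕ} {G : SimpleGraph (Fin n)}
    (hG : G.IsBipartite) : G.chainCoverNumber ≤ chainCoverEstimate G :=
  Nat.sInf_le (exists_isChainCover_sum_blockCoverNumber hG (blockSize_pos n))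

theorem chainCoverEstimate_le {n : ℕ} {G : SimpleGraph (Fin n)} (hG : G.IsBipartite)
    (hn : 3 ≤ n) : chainCoverEstimate G ≤ chainCoverFactor n * G.chainCoverNumber :=
  (sum_blockCoverNumber_le hG (blockSize_pos n) (le_ceil_mul_blockSize hn)).trans_eq <| by
    rw [chainCoverFactor]
    ring

end ChainCover

namespace RAM

/-! ### Programs with a time bound -/

/-- Total correctness with a time bound: started in `s`, the program `p` halts after at most `T`
steps, in a state that satisfies `Q`. -/
def HaltsWithin (p : Prog) (s : State) (T : ℕ) (Q : State → Prop) : Prop :=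
  ∃ t s', Exec p s t s' ∧ t ≤ T ∧ Q s'

theorem HaltsWithin.mono {p : Prog} {s : State} {T T' : ℕ} {Q Q' : State → Prop}
    (h : HaltsWithin p s T Q) (hT : T ≤ T') (hQ : ∀ s', Q s' → Q' s') : HaltsWithin p s T' Q' := by
  obtain ⟨t, s', hexec, ht, hs'⟩ := h
  exact ⟨t, s', hexec, ht.trans hT, hQ s' hs'⟩

theorem HaltsWithin.assign {x : ℕ} {e : Expr} {s : State} {Q : State → Prop}
    (h : Q (s.setVar x (e.eval s))) : HaltsWithin (.assign x e) s (e.cost + 1) Q :=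
  ⟨_, _, .assign x e s, le_rfl, h⟩

theorem HaltsWithin.assign_seq {x : ℕ} {e : Expr} {p : Prog} {s : State} {T : ℕ}
    {Q : State → Prop} (h : HaltsWithin p (s.setVar x (e.eval s)) T Q) :
    HaltsWithin (.seq (.assign x e) p) s (e.cost + 1 + T) Q := by
  obtain ⟨t, s', hexec, ht, hs'⟩ := h
  exact ⟨_, s', .seq (.assign x e s) hexec, Nat.add_le_add_left ht _, hs'⟩

theorem HaltsWithin.seq {p q : Prog} {s : State} {T T' : ℕ} {Q R : State → Prop}
    (hp : HaltsWithin p s T Q) (hq : ∀ s', Q s' → HaltsWithin q s' T' R) :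
    HaltsWithin (.seq p q) s (T + T') R := by
  obtain ⟨t, s', hexec, ht, hs'⟩ := hp
  obtain ⟨t', s'', hexec', ht', hs''⟩ := hq s' hs'
  exact ⟨_, s'', .seq hexec hexec', Nat.add_le_add ht ht', hs''⟩

theorem HaltsWithin.loop {e : Expr} {p : Prog} {T : ℕ} {N : ℕ} {I : ℕ → State → Prop}
    (hguard : ∀ i < N, ∀ s, I i s → e.eval s ≠ 0) (hexit : ∀ s, I N s → e.eval s = 0)
    (hbody : ∀ i < N, ∀ s, I i s → HaltsWithin p s T (I (i + 1))) {s : State} (hs : I 0 s) :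
    HaltsWithin (.loop e p) s (N * (e.cost + 1 + T) + (e.cost + 1)) (I N) := by
  induction N generalizing I s with
  | zero => exact ⟨_, s, .loop_done (hexit s hs), by simp, hs⟩
  | succ N ih =>
    obtain ⟨t, s', hexec, ht, hs'⟩ := hbody 0 N.succ_pos s hs
    obtain ⟨t', s'', hexec', ht', hs''⟩ := ih (I := fun i => I (i + 1))
      (fun i hi => hguard (i + 1) (Nat.succ_lt_succ hi)) hexit
      (fun i hi => hbody (i + 1) (Nat.succ_lt_succ hi)) hs'
    refine ⟨_, s'', .loop_step (hguard 0 N.succ_pos s hs) hexec hexec', ?_, hs''⟩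
    rw [Nat.succ_mul]
    omega

theorem State.setVar_var_self (s : State) (x v : ℕ) : (s.setVar x v).var x = v :=
  Function.update_self ..

theorem State.setVar_var_of_ne (s : State) {x y : ℕ} (v : ℕ) (h : y ≠ x) :
    (s.setVar x v).var y = s.var y :=
  Function.update_of_ne h ..

/-- The states `s` and `s'` have the same arrays and agree in the registers below `m`. -/
def AgreeBelow (m : ℕ) (s s' : State) : Prop :=
  s'.arr = s.arr ∧ ∀ x < m, s'.var x = s.var x

theorem AgreeBelow.refl (m : ℕ) (s : State) : AgreeBelow m s s := ⟨rfl, fun _ _ => rfl⟩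

theorem AgreeBelow.trans {m : ℕ} {s s' s'' : State} (h : AgreeBelow m s s')
    (h' : AgreeBelow m s' s'') : AgreeBelow m s s'' :=
  ⟨h'.1.trans h.1, fun x hx => (h'.2 x hx).trans (h.2 x hx)⟩

theorem AgreeBelow.mono {m m' : ℕ} {s s' : State} (h : AgreeBelow m' s s') (hm : m ≤ m') :
    AgreeBelow m s s' :=
  ⟨h.1, fun x hx => h.2 x (hx.trans_le hm)⟩

theorem AgreeBelow.setVar {m x : ℕ} {s s' : State} (h : AgreeBelow m s s') (hx : m ≤ x) (v : ℕ) :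
    AgreeBelow m s (s'.setVar x v) :=
  ⟨h.1, fun y hy => (s'.setVar_var_of_ne v (hy.trans_le hx).ne).trans (h.2 y hy)⟩

/-! ### Functions computable in polynomial time -/

/-- The inputs of the algorithms: graphs with the vertices `0, …, n - 1`. -/
abbrev Input : Type := Σ n : ℕ, SimpleGraph (Fin n)

/-- A type of contexts, that is, of inputs together with the values of finitely many variables.
A subroutine computes a function of a context; a context `α × ℕ` has one more variable than a
context `α`, such as the variable of a sum or of a quantifier over a function on `α`. -/
class Context (α : Type*) where
  input : α → Input
  vars : α → List ℕ

instance : Context Input where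
  input := id
  vars _ := []

instance {α : Type*} [Context α] : Context (α × ℕ) where
  input a := Context.input a.1
  vars a := a.2 :: Context.vars a.1

section Context

variable {α : Type*} [Context α]

/-- The number of vertices of the input graph of a context. -/
abbrev order (a : α) : ℕ := (Context.input a).1

/-- The input graph of a context. -/
abbrev graph (a : α) : SimpleGraph (Fin (order a)) := (Context.input a).2

/-- The size of a context, in which running times are measured: the number of vertices plus the
values of the variables. These may be counted in unary, since the algorithm only uses variables of
polynomial value. -/
def size (a : α) : ℕ := order a + (Context.vars a).sum

theorem size_pair (a : α × ℕ) : size a = size a.1 + a.2 := by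
  simp only [size, order, Context.input, Context.vars, List.sum_cons]
  ring

/-- The state `s` holds the context `a`: the input graph is in the array `0`, its order in the
register `0`, and the variables are in the registers `ρ`, the most recent one first. -/
structure Holds (ρ : List ℕ) (s : State) (a : α) : Prop where
  arr_eq : s.arr = (initState (graph a)).arr
  order_eq : s.var 0 = order a
  vars_eq : ρ.map s.var = Context.vars a

theorem Holds.cons {ρ : List ℕ} {s : State} {a : α} (h : Holds ρ s a) (r : ℕ) :
    Holds (r :: ρ) s (a, s.var r) :=
  ⟨h.arr_eq, h.order_eq, congrArg (s.var r :: ·) h.vars_eq⟩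

theorem Holds.tail {ρ : List ℕ} {s : State} {a : α × ℕ} (h : Holds ρ s a) :
    Holds ρ.tail s a.1 :=
  ⟨h.arr_eq, h.order_eq, by rw [List.map_tail, h.vars_eq]; rfl⟩

theorem Holds.var_headD {ρ : List ℕ} {s : State} {a : α × ℕ} (h : Holds ρ s a) :
    s.var (ρ.headD 0) = a.2 := by
  cases ρ with
  | nil => exact absurd h.vars_eq (List.cons_ne_nil _ _).symm
  | cons r ρ => exact (List.cons.inj h.vars_eq).1

theorem Holds.of_agreeBelow {ρ : List ℕ} {s s' : State} {a : α} {m : ℕ} (h : Holds ρ s a)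
    (hm : ∀ r ∈ 0 :: ρ, r < m) (hs : AgreeBelow m s s') : Holds ρ s' a where
  arr_eq := hs.1.trans h.arr_eq
  order_eq := (hs.2 0 (hm 0 List.mem_cons_self)).trans h.order_eq
  vars_eq := by
    rw [← h.vars_eq]
    exact List.map_congr_left fun r hr => hs.2 r (hm r (List.mem_cons_of_mem _ hr))

/-- Growth bounded by a polynomial in the size of the context. -/
def PolyBounded (f : α → ℕ) : Prop := ∃ P : Polynomial ℕ, ∀ a, f a ≤ P.eval (size a)

theorem monotone_polynomial_eval {R : Type*} [CommSemiring R] [PartialOrder R] [IsOrderedRing R]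
    [CanonicallyOrderedAdd R] (P : Polynomial R) : Monotone fun x => P.eval x := by
  induction P using Polynomial.induction_on' with
  | add P Q hP hQ => simpa only [Polynomial.eval_add] using hP.add hQ
  | monomial n a =>
    intro x y hxy
    simp only [Polynomial.eval_monomial]
    exact mul_le_mul_of_nonneg_left (pow_le_pow_left₀ zero_le hxy n) zero_le

namespace PolyBounded

variable {f g : α → ℕ}

theorem mono (hg : PolyBounded g) (h : ∀ a, f a ≤ g a) : PolyBounded f :=
  hg.imp fun _ hP a => (h a).trans (hP a)

theorem const (k : ℕ) : PolyBounded fun _ : α => k := ⟨.C k, fun _ => by simp⟩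

theorem size : PolyBounded (size : α → ℕ) := ⟨.X, fun _ => by simp⟩

theorem snd : PolyBounded fun a : α × ℕ => a.2 :=
  PolyBounded.size.mono fun a => (Nat.le_add_left _ _).trans_eq (size_pair a).symm

theorem add (hf : PolyBounded f) (hg : PolyBounded g) : PolyBounded fun a => f a + g a := by
  obtain ⟨P, hP⟩ := hf
  obtain ⟨Q, hQ⟩ := hg
  exact ⟨P + Q, fun a => by simpa using Nat.add_le_add (hP a) (hQ a)⟩

theorem mul (hf : PolyBounded f) (hg : PolyBounded g) : PolyBounded fun a => f a * g a := by
  obtain ⟨P, hP⟩ := hf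
  obtain ⟨Q, hQ⟩ := hg
  exact ⟨P * Q, fun a => by simpa using Nat.mul_le_mul (hP a) (hQ a)⟩

theorem eval (hf : PolyBounded f) (P : Polynomial ℕ) : PolyBounded fun a => P.eval (f a) := by
  obtain ⟨Q, hQ⟩ := hf
  exact ⟨P.comp Q, fun a => by
    simpa only [Polynomial.eval_comp] using monotone_polynomial_eval P (hQ a)⟩

theorem comp {β : Type*} [Context β] {φ : β → α} (hf : PolyBounded f)
    (hφ : ∀ b, RAM.size (φ b) ≤ RAM.size b) : PolyBounded fun b => f (φ b) := by
  obtain ⟨P, hP⟩ := hf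
  exact ⟨P, fun b => (hP (φ b)).trans (monotone_polynomial_eval P (hφ b))⟩

theorem comp_fst (hf : PolyBounded f) : PolyBounded fun a : α × ℕ => f a.1 :=
  hf.comp fun a => (Nat.le_add_right _ _).trans_eq (size_pair a).symm

theorem bind {h : α × ℕ → ℕ} (hf : PolyBounded f) (hh : PolyBounded h) :
    PolyBounded fun a => h (a, f a) := by
  obtain ⟨P, hP⟩ := hh
  exact ((PolyBounded.size.add hf).eval P).mono fun a => (hP (a, f a)).trans_eq (by rw [size_pair])

theorem exists_bound_of_le {h : α × ℕ → ℕ} (hf : PolyBounded f) (hh : PolyBounded h) :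
    ∃ B : α → ℕ, PolyBounded B ∧ ∀ a, ∀ i ≤ f a, h (a, i) ≤ B a := by
  obtain ⟨P, hP⟩ := hh
  refine ⟨_, (PolyBounded.size.add hf).eval P, fun a i hi => (hP (a, i)).trans ?_⟩
  rw [size_pair]
  exact monotone_polynomial_eval P (Nat.add_le_add_left hi _)

theorem sum {h : α → ℕ → ℕ} (hh : PolyBounded fun a : α × ℕ => h a.1 a.2) :
    PolyBounded fun a : α × ℕ => ∑ i ∈ Finset.range a.2, h a.1 i := by
  obtain ⟨P, hP⟩ := hh
  refine (snd.mul (size.eval P)).mono fun a => ?_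
  have hle : ∀ i ∈ Finset.range a.2, h a.1 i ≤ P.eval (RAM.size a) := fun i hi => by
    refine (hP (a.1, i)).trans (monotone_polynomial_eval P ?_)
    rw [size_pair, size_pair a]
    exact Nat.add_le_add_left (Finset.mem_range.1 hi).le _
  simpa using Finset.sum_le_card_nsmul _ _ _ hle

end PolyBounded

/-- Started in a state that holds a context `a` in the registers `ρ`, the program `p` stores `f a`
in the register `m` within `T a` steps, without changing the arrays and the registers below `m`. -/
def Computes (p : Prog) (m : ℕ) (ρ : List ℕ) (f T : α → ℕ) : Prop :=
  ∀ s a, Holds ρ s a → HaltsWithin p s (T a) fun s' => AgreeBelow m s s' ∧ s'.var m = f a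

/-- `f` is computable in polynomial time by a subroutine whose result and workspace can be placed
above any given registers. The values of `f` are also required to be polynomially bounded, so that
they can be stored in variables. -/
def PolyTime (f : α → ℕ) : Prop :=
  PolyBounded f ∧ ∀ m ρ, (∀ r ∈ 0 :: ρ, r < m) →
    ∃ p T, PolyBounded T ∧ Computes p m ρ f T

namespace PolyTime

variable {f g : α → ℕ}

theorem of_expr (hf : PolyBounded f)
    (h : ∀ ρ : List ℕ, ∃ e : Expr, ∀ s a, Holds ρ s a → e.eval s = f a) : PolyTime f := by
  refine ⟨hf, fun m ρ _ => ?_⟩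
  obtain ⟨e, he⟩ := h ρ
  refine ⟨.assign m e, fun _ => e.cost + 1, .const _, fun s a hs => .assign ⟨?_, ?_⟩⟩
  · exact (AgreeBelow.refl m s).setVar le_rfl _
  · rw [s.setVar_var_self, he s a hs]

theorem const (k : ℕ) : PolyTime fun _ : α => k :=
  .of_expr (.const k) fun _ => ⟨.const k, fun _ _ _ => rfl⟩

theorem order : PolyTime (order : α → ℕ) :=
  .of_expr (PolyBounded.size.mono fun _ => Nat.le_add_right _ _)
    fun _ => ⟨.var 0, fun _ _ hs => hs.order_eq⟩

theorem snd : PolyTime fun a : α × ℕ => a.2 :=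
  .of_expr .snd fun ρ => ⟨.var (ρ.headD 0), fun _ _ hs => hs.var_headD⟩

theorem comp {β : Type*} [Context β] {φ : β → α} (hf : PolyTime f)
    (hsize : ∀ b, size (φ b) ≤ size b)
    (hφ : ∀ ρ, ∃ ρ' ⊆ 0 :: ρ, ∀ s b, Holds ρ s b → Holds ρ' s (φ b)) :
    PolyTime fun b => f (φ b) := by
  refine ⟨hf.1.comp hsize, fun m ρ hm => ?_⟩
  obtain ⟨ρ', hρ', hholds⟩ := hφ ρ
  obtain ⟨p, T, hT, hp⟩ := hf.2 m ρ' fun r hr => hm r <| by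
    rcases List.mem_cons.1 hr with rfl | hr
    · exact List.mem_cons_self
    · exact hρ' hr
  exact ⟨p, fun b => T (φ b), hT.comp hsize, fun s b hs => hp s (φ b) (hholds s b hs)⟩

theorem comp_fst (hf : PolyTime f) : PolyTime fun a : α × ℕ => f a.1 :=
  hf.comp (fun a => (Nat.le_add_right _ _).trans_eq (size_pair a).symm) fun ρ =>
    ⟨ρ.tail, fun _ hr => List.mem_cons_of_mem _ (List.mem_of_mem_tail hr), fun _ _ hs => hs.tail⟩

theorem comp_fst_fst_snd {h : α × ℕ → ℕ} (hh : PolyTime h) :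
    PolyTime fun a : (α × ℕ) × ℕ => h (a.1.1, a.2) := by
  refine hh.comp (fun a => ?_) fun ρ => ⟨ρ.headD 0 :: ρ.tail.tail, ?_, fun s a hs => ?_⟩
  · rw [size_pair, size_pair a, size_pair a.1]
    exact Nat.add_le_add_right (Nat.le_add_right _ _) _
  · rcases ρ with - | ⟨r, ρ⟩
    · exact List.Subset.refl _
    · exact List.subset_cons_of_subset _ (List.cons_subset_cons r (List.tail_subset ρ))
  · exact hs.var_headD ▸ hs.tail.tail.cons _

theorem bind {h : α × ℕ → ℕ} (hf : PolyTime f) (hh : PolyTime h) :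
    PolyTime fun a => h (a, f a) := by
  refine ⟨hf.1.bind hh.1, fun m ρ hm => ?_⟩
  obtain ⟨p, T, hT, hp⟩ := hf.2 m ρ hm
  obtain ⟨q, U, hU, hq⟩ := hh.2 (m + 1) (m :: ρ) fun r hr => by
    simp only [List.mem_cons] at hr hm
    grind
  refine ⟨.seq p (.seq q (.assign m (.var (m + 1)))), fun a => T a + (U (a, f a) + 2),
    hT.add ((hf.1.bind hU).add (.const 2)), fun s a hs => (hp s a hs).seq ?_⟩
  rintro s₁ ⟨hs₁, hm₁⟩
  have hold := (hs.of_agreeBelow hm hs₁).cons m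
  rw [hm₁] at hold
  refine (hq s₁ _ hold).seq ?_
  rintro s₂ ⟨hs₂, hm₂⟩
  refine .assign ⟨(hs₁.trans (hs₂.mono m.le_succ)).setVar le_rfl _, ?_⟩
  rw [s₂.setVar_var_self, Expr.eval, hm₂]

theorem of_expr₂ {h : α → ℕ → ℕ → ℕ} (hf : PolyTime f) (hg : PolyTime g)
    (hh : PolyBounded fun a : (α × ℕ) × ℕ => h a.1.1 a.1.2 a.2) (e : ℕ → ℕ → Expr)
    (he : ∀ r r' s a, s.arr = (initState (graph a)).arr →
      (e r r').eval s = h a (s.var r) (s.var r')) : PolyTime fun a => h a (f a) (g a) :=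
  hf.bind <| hg.comp_fst.bind (h := fun a => h a.1.1 a.1.2 a.2) <| .of_expr hh
    fun ρ => ⟨e (ρ.tail.headD 0) (ρ.headD 0), fun s a hs => by
      rw [he _ _ s a.1.1 hs.arr_eq, hs.var_headD, hs.tail.var_headD]⟩

theorem of_eq (hf : PolyTime f) (h : ∀ a, f a = g a) : PolyTime g := funext h ▸ hf

theorem add (hf : PolyTime f) (hg : PolyTime g) : PolyTime fun a => f a + g a :=
  of_expr₂ hf hg (PolyBounded.snd.comp_fst.add .snd) (fun r r' => .add (.var r) (.var r'))
    fun _ _ _ _ _ => rfl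

theorem sub (hf : PolyTime f) (hg : PolyTime g) : PolyTime fun a => f a - g a :=
  of_expr₂ hf hg (PolyBounded.snd.comp_fst.mono fun _ => Nat.sub_le _ _)
    (fun r r' => .sub (.var r) (.var r')) fun _ _ _ _ _ => rfl

theorem read (hf : PolyTime f) : PolyTime fun a => (initState (graph a)).arr 0 (f a) := by
  refine of_expr₂ (h := fun a x _ => (initState (graph a)).arr 0 x) hf hf
    ((PolyBounded.const 1).mono fun a => ?_) (fun r _ => .read 0 (.var r)) fun r _ s a hs => ?_
  · simp only [initState]
    split <;> simp
  · simp only [Expr.eval, hs]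

end PolyTime

/-! ### Bounded recursion -/

/-- One round of a primitive recursion with the value in the register `m + 1` and the index in the
register `m + 2`, where `p` computes the next value in the register `m + 3`. -/
def recStep (p : Prog) (m : ℕ) : Prog :=
  .seq p (.seq (.assign (m + 1) (.var (m + 3)))
    (.assign (m + 2) (.add (.var (m + 2)) (.const 1))))

theorem haltsWithin_recStep {p : Prog} {m : ℕ} {ρ : List ℕ} {g T : (α × ℕ) × ℕ → ℕ}
    (hp : Computes p (m + 3) ((m + 1) :: (m + 2) :: ρ) g T) {s : State} {a : α} (hs : Holds ρ s a) :
    HaltsWithin (recStep p m) s (T ((a, s.var (m + 2)), s.var (m + 1)) + 6) fun s' =>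
      AgreeBelow (m + 1) s s' ∧ s'.var (m + 1) = g ((a, s.var (m + 2)), s.var (m + 1)) ∧
        s'.var (m + 2) = s.var (m + 2) + 1 := by
  refine (hp s _ ((hs.cons (m + 2)).cons (m + 1))).seq ?_
  rintro s₁ ⟨hs₁, hvalue⟩
  refine .assign_seq (.assign ⟨((hs₁.mono (by omega)).setVar le_rfl _).setVar (by omega) _, ?_, ?_⟩)
  · rw [State.setVar_var_of_ne _ _ (by omega), State.setVar_var_self, Expr.eval, hvalue]
  · rw [State.setVar_var_self]
    simp only [Expr.eval]
    rw [State.setVar_var_of_ne _ _ (by omega), hs₁.2 _ (by omega)]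

/-- The recursion with the step `p`, as many times as the register `m` says. -/
def recLoop (p : Prog) (m : ℕ) : Prog := .loop (.sub (.var m) (.var (m + 2))) (recStep p m)

theorem haltsWithin_recLoop {p : Prog} {m : ℕ} {ρ : List ℕ} {g T : (α × ℕ) × ℕ → ℕ}
    (hp : Computes p (m + 3) ((m + 1) :: (m + 2) :: ρ) g T) (hm : ∀ r ∈ 0 :: ρ, r < m) {a : α}
    {u : ℕ → ℕ} (hu : ∀ i, u (i + 1) = g ((a, i), u i)) {s : State} {B : ℕ}
    (hB : ∀ i < s.var m, T ((a, i), u i) ≤ B) (hs : Holds ρ s a) (h0 : s.var (m + 2) = 0)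
    (hu0 : s.var (m + 1) = u 0) :
    HaltsWithin (recLoop p m) s (s.var m * (4 + (B + 6)) + 4) fun s' =>
      AgreeBelow m s s' ∧ s'.var (m + 1) = u (s.var m) := by
  let I (i : ℕ) (s' : State) : Prop :=
    AgreeBelow (m + 1) s s' ∧ s'.var (m + 1) = u i ∧ s'.var (m + 2) = i
  have hguard : ∀ i s', I i s' →
      (Expr.sub (.var m) (.var (m + 2))).eval s' = s.var m - i := fun i s' hI => by
    rw [Expr.eval, Expr.eval, Expr.eval, hI.1.2 m m.lt_succ_self, hI.2.2]
  refine (HaltsWithin.loop (I := I) (N := s.var m) (T := B + 6)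
    (fun i hi s' hI => ?_) (fun s' hI => ?_) (fun i hi s' hI => ?_)
    ⟨AgreeBelow.refl _ s, hu0, h0⟩).mono le_rfl fun s' hI => ⟨hI.1.mono m.le_succ, hI.2.1⟩
  · rw [hguard i s' hI]
    omega
  · rw [hguard _ s' hI, Nat.sub_self]
  · obtain ⟨hs', hvalue, hindex⟩ := hI
    have hstep := haltsWithin_recStep hp (hs.of_agreeBelow hm (hs'.mono m.le_succ))
    rw [hvalue, hindex] at hstep
    refine hstep.mono (Nat.add_le_add_right (hB i hi) 6) ?_
    rintro s'' ⟨hs'', hvalue', hindex'⟩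
    exact ⟨hs'.trans hs'', hvalue'.trans (hu i).symm, hindex'⟩

namespace PolyTime

variable {f g : α → ℕ}

theorem boundedRec {e : α → ℕ} {u : α → ℕ → ℕ} {g : (α × ℕ) × ℕ → ℕ} (he : PolyTime e)
    (h0 : PolyTime fun a => u a 0) (hg : PolyTime g)
    (hsucc : ∀ a i, u a (i + 1) = g ((a, i), u a i))
    (hu : PolyBounded fun a : α × ℕ => u a.1 a.2) : PolyTime fun a => u a (e a) := by
  refine ⟨he.1.bind hu, fun m ρ hm => ?_⟩
  obtain ⟨p, T, hT, hp⟩ := he.2 m ρ hm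
  obtain ⟨q, U, hU, hq⟩ := h0.2 (m + 1) ρ fun r hr => (hm r hr).trans m.lt_succ_self
  obtain ⟨w, W, hW, hw⟩ := hg.2 (m + 3) ((m + 1) :: (m + 2) :: ρ) fun r hr => by
    simp only [List.mem_cons] at hr hm
    grind
  obtain ⟨B, hB, hWB⟩ := he.1.exists_bound_of_le (hu.bind hW)
  refine ⟨.seq p (.seq q (.seq (.assign (m + 2) (.const 0))
    (.seq (recLoop w m) (.assign m (.var (m + 1)))))),
    fun a => T a + (U a + (2 + (e a * (4 + (B a + 6)) + 4 + 2))),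
    hT.add (hU.add ((PolyBounded.const 2).add (((he.1.mul ((PolyBounded.const 4).add
      (hB.add (.const 6)))).add (.const 4)).add (.const 2)))), fun s a hs => (hp s a hs).seq ?_⟩
  rintro s₁ ⟨hs₁, hcount⟩
  have hold₁ := hs.of_agreeBelow hm hs₁
  refine (hq s₁ a hold₁).seq ?_
  rintro s₂ ⟨hs₂, hvalue⟩
  have hs₃ : AgreeBelow (m + 1) s₁ (s₂.setVar (m + 2) 0) := hs₂.setVar (by omega) 0
  have hcount₃ := (hs₃.2 m m.lt_succ_self).trans hcount
  refine .assign_seq (.seq (Q := fun s' => AgreeBelow m s s' ∧ s'.var (m + 1) = u a (e a)) ?_ ?_)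
  · have hloop := haltsWithin_recLoop hw hm (hsucc a) (B := B a)
      (fun i hi => hWB a i (hi.le.trans_eq hcount₃))
      (hold₁.of_agreeBelow hm (hs₃.mono m.le_succ)) (State.setVar_var_self ..)
      ((State.setVar_var_of_ne _ _ (by omega)).trans hvalue)
    rw [hcount₃] at hloop
    exact hloop.mono le_rfl fun s' hs' => ⟨(hs₁.trans (hs₃.mono m.le_succ)).trans hs'.1, hs'.2⟩
  · rintro s₄ ⟨hs₄, hvalue₄⟩
    refine .assign ⟨hs₄.setVar le_rfl _, ?_⟩
    rw [State.setVar_var_self, Expr.eval, hvalue₄]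

theorem sum {e : α → ℕ} {h : α → ℕ → ℕ} (he : PolyTime e)
    (hh : PolyTime fun a : α × ℕ => h a.1 a.2) :
    PolyTime fun a => ∑ i ∈ Finset.range (e a), h a i :=
  boundedRec (u := fun a i => ∑ j ∈ Finset.range i, h a j) he (.const 0)
    (add .snd hh.comp_fst) (fun a i => by rw [Finset.sum_range_succ, add_comm])
    hh.1.sum

theorem mul (hf : PolyTime f) (hg : PolyTime g) : PolyTime fun a => f a * g a :=
  (hf.sum (h := fun a _ => g a) hg.comp_fst).of_eq fun a => by simp

end PolyTime

/-! ### Predicates decidable in polynomial time -/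

open Classical in
/-- Decidability in polynomial time of a predicate on contexts. -/
def PolyDec (P : α → Prop) : Prop := PolyTime fun a => if P a then 1 else 0

namespace PolyDec

variable {f g : α → ℕ} {P Q : α → Prop}

theorem of_iff (hP : PolyDec P) (h : ∀ a, P a ↔ Q a) : PolyDec Q :=
  (funext fun a => propext (h a) : P = Q) ▸ hP

theorem lt (hf : PolyTime f) (hg : PolyTime g) : PolyDec fun a => f a < g a :=
  ((PolyTime.const 1).sub ((PolyTime.const 1).sub (hg.sub hf))).of_eq fun a => by
    split <;> omega

theorem not (hP : PolyDec P) : PolyDec fun a => ¬ P a :=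
  ((PolyTime.const 1).sub hP).of_eq fun a => by by_cases h : P a <;> simp [h]

theorem le (hf : PolyTime f) (hg : PolyTime g) : PolyDec fun a => f a ≤ g a :=
  (lt hg hf).not.of_iff fun _ => not_lt

theorem and (hP : PolyDec P) (hQ : PolyDec Q) : PolyDec fun a => P a ∧ Q a :=
  (hP.mul hQ).of_eq fun a => by by_cases hp : P a <;> by_cases hq : Q a <;> simp [hp, hq]

theorem eq (hf : PolyTime f) (hg : PolyTime g) : PolyDec fun a => f a = g a :=
  ((le hf hg).and (le hg hf)).of_iff fun _ => le_antisymm_iff.symm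

theorem imp (hP : PolyDec P) (hQ : PolyDec Q) : PolyDec fun a => P a → Q a :=
  (hP.and hQ.not).not.of_iff fun a => by rw [not_and, not_not]

theorem count {e : α → ℕ} {P : α → ℕ → Prop} [∀ a, DecidablePred (P a)] (he : PolyTime e)
    (hP : PolyDec fun a : α × ℕ => P a.1 a.2) :
    PolyTime fun a => ((Finset.range (e a)).filter (P a)).card := by
  simp only [Finset.card_filter]
  exact .sum he (hP.of_eq fun _ => by congr)

theorem exists_lt {e : α → ℕ} {P : α → ℕ → Prop} (he : PolyTime e)
    (hP : PolyDec fun a : α × ℕ => P a.1 a.2) : PolyDec fun a => ∃ i < e a, P a i := by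
  classical
  refine (lt (.const 0) (count he hP)).of_iff fun _ => ?_
  simp only [Finset.card_pos, Finset.Nonempty, Finset.mem_filter, Finset.mem_range]

theorem forall_lt {e : α → ℕ} {P : α → ℕ → Prop} (he : PolyTime e)
    (hP : PolyDec fun a : α × ℕ => P a.1 a.2) : PolyDec fun a => ∀ i < e a, P a i :=
  (exists_lt (P := fun a i => ¬ P a i) he hP.not).not.of_iff fun _ => by push Not; rfl

end PolyDec

namespace PolyTime

variable {f g : α → ℕ}

theorem sInf {e : α → ℕ} {P : α → ℕ → Prop} (he : PolyTime e)
    (hP : PolyDec fun a : α × ℕ => P a.1 a.2) (hPe : ∀ a, P a (e a)) :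
    PolyTime fun a => InfSet.sInf {i | P a i} := by
  classical
  refine (PolyDec.count (P := fun a i => ∀ j < i + 1, ¬ P a j) he
    (.forall_lt (snd.add (.const 1)) ?_)).of_eq fun a => ?_
  · exact hP.not.comp_fst_fst_snd
  · have hmem : P a (InfSet.sInf {i | P a i}) := Nat.sInf_mem (s := {i | P a i}) ⟨e a, hPe a⟩
    suffices (Finset.range (e a)).filter (fun i => ∀ j < i + 1, ¬ P a j) =
        Finset.range (InfSet.sInf {i | P a i}) by rw [this, Finset.card_range]
    ext i
    simp only [Finset.mem_filter, Finset.mem_range]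
    refine ⟨fun h => ?_, fun hi => ⟨hi.trans_le (Nat.sInf_le (hPe a)), fun j hj => ?_⟩⟩
    · by_contra! hi
      exact h.2 _ (Nat.lt_succ_of_le hi) hmem
    · exact Nat.notMem_of_lt_sInf ((Nat.le_of_lt_succ hj).trans_lt hi)

theorem div (hf : PolyTime f) (hg : PolyTime g) (h : ∀ a, 0 < g a) :
    PolyTime fun a => f a / g a := by
  refine (sInf (P := fun a i => f a < (i + 1) * g a) hf ?_ fun a => ?_).of_eq fun a => ?_
  · exact .lt hf.comp_fst ((snd.add (.const 1)).mul hg.comp_fst)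
  · exact (Nat.lt_succ_self _).trans_le (Nat.le_mul_of_pos_right _ (h a))
  · simp only [← Nat.div_lt_iff_lt_mul (h a), Nat.lt_succ_iff]
    exact csInf_Ici

theorem mod (hf : PolyTime f) (hg : PolyTime g) (h : ∀ a, 0 < g a) :
    PolyTime fun a => f a % g a :=
  (hf.sub (hg.mul (hf.div hg h))).of_eq fun _ =>
    Nat.sub_eq_of_eq_add (Nat.mod_add_div ..).symm

theorem pow_const (hf : PolyTime f) (k : ℕ) : PolyTime fun a => f a ^ k := by
  induction k with
  | zero => exact const 1
  | succ k ih => exact ih.mul hf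

theorem min (hf : PolyTime f) (hg : PolyTime g) : PolyTime fun a => min (f a) (g a) :=
  (hf.sub (hf.sub hg)).of_eq fun _ => by omega

theorem min_pow {b : α → ℕ} (hb : PolyTime b) (hf : PolyTime f) (hg : PolyTime g)
    (h : ∀ a, 0 < b a) : PolyTime fun a => Min.min (b a) (f a ^ g a) := by
  refine boundedRec (u := fun a i => Min.min (b a) (f a ^ i)) hg ((const 1).of_eq fun _ => ?_)
    (min hb.comp_fst.comp_fst (snd.mul hf.comp_fst.comp_fst)) (fun a i => ?_)
    (hb.1.comp_fst.mono fun _ => min_le_left _ _)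
  · rw [pow_zero, min_eq_right (h _)]
  · rcases (f a).eq_zero_or_pos with h0 | h0
    · simp [h0]
    · have hle : b a ≤ b a * f a := Nat.le_mul_of_pos_right _ h0
      rw [pow_succ, min_mul_of_nonneg _ _ (f a).zero_le, ← min_assoc, min_eq_left hle]

theorem exists_prog {f : Input → ℕ} (hf : PolyTime f) :
    ∃ (p : Prog) (T : Polynomial ℕ), ∀ (n : ℕ) (G : SimpleGraph (Fin n)),
      ∃ t s, Exec p (initState G) t s ∧ t ≤ T.eval n ∧ s.output = f ⟨n, G⟩ := by
  obtain ⟨p, U, ⟨T, hT⟩, hp⟩ := hf.2 1 [] (by simp)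
  refine ⟨.seq p (.assign 0 (.var 1)), T + 2, fun n G => ?_⟩
  obtain ⟨t, s, hexec, ht, hs⟩ := (hp (initState G) ⟨n, G⟩ ⟨rfl, rfl, rfl⟩).seq
    (q := .assign 0 (.var 1)) (R := fun s => s.output = f ⟨n, G⟩) fun s hs =>
      .assign ((s.setVar_var_self 0 _).trans hs.2)
  refine ⟨t, s, hexec, ht.trans ?_, hs⟩
  rw [Polynomial.eval_add, Polynomial.eval_ofNat]
  exact Nat.add_le_add_right (hT ⟨n, G⟩) 2

end PolyTime
end Context
end RAM

namespace ChainCover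

/-! ### The algorithm -/

section Algorithm

open RAM

variable {n : ℕ} {G : SimpleGraph (Fin n)}

/-- Adjacency of natural numbers as vertices of `G`, which lets the quantifiers of an algorithm
range over natural numbers. -/
def AdjNat (G : SimpleGraph (Fin n)) (u v : ℕ) : Prop :=
  ∃ (hu : u < n) (hv : v < n), G.Adj ⟨u, hu⟩ ⟨v, hv⟩

theorem initState_arr_pos_iff {u v : ℕ} (hv : v < n) :
    0 < (initState G).arr 0 (u * n + v) ↔ AdjNat G u v := by
  simp only [initState]
  constructor
  · intro h
    obtain ⟨i, j, hij, hadj⟩ : ∃ i j : Fin n, u * n + v = i * n + j ∧ G.Adj i j := by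
      by_contra hnot
      simp [hnot] at h
    have hn : 0 < n := v.zero_le.trans_lt hv
    obtain rfl : u = i := by
      simpa [Nat.mul_comm _ n, Nat.mul_add_div hn, Nat.div_eq_of_lt, hv, j.2] using
        congrArg (· / n) hij
    obtain rfl : v = j := Nat.add_left_cancel hij
    exact ⟨i.2, j.2, hadj⟩
  · rintro ⟨hu, _, hadj⟩
    rw [if_pos ⟨rfl, ⟨u, hu⟩, ⟨v, hv⟩, rfl, hadj⟩]
    exact one_pos

theorem coverable_iff {k q c : ℕ} : Coverable G k q c ↔
    ∃ x < k ^ (k * k), ∀ u < n, u / k = q → ∀ v < n, AdjNat G u v →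
      ∃ j < c, ∀ w < n, w / k = q → rank k x j w ≤ rank k x j u → AdjNat G w v := by
  simp only [Coverable, IsRankCover, InitialAdj, block, AdjNat, Set.mem_ofPred_eq, Fin.forall_iff,
    Fin.exists_iff]
  refine exists_congr fun x => and_congr_right fun _ => ⟨?_, ?_⟩
  · rintro h u hu huq v - ⟨_, hv, huv⟩
    obtain ⟨j, hj, -, hw⟩ := h u hu huq v hv huv
    exact ⟨j, hj, fun w hwn hwq hle => ⟨hwn, hv, hw w hwn hwq hle⟩⟩
  · intro h u hu huq v hv huv
    obtain ⟨j, hj, hw⟩ := h u hu huq v hv ⟨hu, hv, huv⟩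
    exact ⟨j, hj, huq, fun w hwn hwq hle => (hw w hwn hwq hle).2.2⟩

variable {α : Type*} [Context α] {q c x j u v : α → ℕ}

theorem polyDec_adjNat (hu : PolyTime u) (hv : PolyTime v) :
    PolyDec fun a => AdjNat (graph a) (u a) (v a) := by
  refine ((PolyDec.lt hv .order).and
    (.lt (.const 0) (.read ((hu.mul .order).add hv)))).of_iff fun a => ?_
  exact ⟨fun h => (initState_arr_pos_iff h.1).1 h.2,
    fun h => ⟨h.2.1, (initState_arr_pos_iff h.2.1).2 h⟩⟩

theorem polyTime_blockSize : PolyTime fun a : α => blockSize (order a) := by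
  refine (PolyTime.sInf (P := fun a i => order a ≤ i ^ (i * i)) .order ?_ fun _ => ?_).add
    (.const 4)
  · refine (PolyDec.le (PolyTime.order.comp_fst) (PolyTime.min_pow
      (PolyTime.order.comp_fst.add (.const 1)) .snd (.mul .snd .snd)
      fun _ => Nat.succ_pos _)).of_iff fun a => ?_
    omega
  · exact le_self_pow_mul_self _

theorem polyTime_blockSize_pow :
    PolyTime fun a : α => blockSize (order a) ^ (blockSize (order a) * blockSize (order a)) :=
  (PolyTime.min_pow ((PolyTime.order.add (.const 2)).pow_const 108) polyTime_blockSize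
    (polyTime_blockSize.mul polyTime_blockSize) fun _ => by positivity).of_eq
    fun _ => min_eq_right (blockSize_pow_le _)

theorem polyTime_rank {k w : α → ℕ} (hk : PolyTime k) (hx : PolyTime x) (hj : PolyTime j)
    (hw : PolyTime w) (hk0 : ∀ a, 0 < k a) : PolyTime fun a => rank (k a) (x a) (j a) (w a) := by
  have hpow := PolyTime.min_pow (hx.add (.const 1)) hk ((hw.mod hk hk0).add (hk.mul hj))
    fun _ => Nat.succ_pos _
  refine ((hx.div hpow fun a => ?_).mod hk hk0).of_eq fun a => ?_
  · exact lt_min (Nat.succ_pos _) (Nat.pow_pos (hk0 a))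
  · rw [rank]
    rcases le_total (x a + 1) (k a ^ (w a % k a + k a * j a)) with hle | hle
    · rw [min_eq_left hle, Nat.div_eq_of_lt (Nat.lt_succ_self _), Nat.div_eq_of_lt hle]
    · rw [min_eq_right hle]

theorem polyDec_forall_rank_le (hq : PolyTime q) (hx : PolyTime x) (hj : PolyTime j)
    (hu : PolyTime u) (hv : PolyTime v) :
    PolyDec fun a => ∀ w < order a, w / blockSize (order a) = q a →
      rank (blockSize (order a)) (x a) (j a) w ≤ rank (blockSize (order a)) (x a) (j a) (u a) →
        AdjNat (graph a) w (v a) := by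
  have hk : PolyTime fun a : α × ℕ => blockSize (order a.1) := polyTime_blockSize.comp_fst
  have hk0 (a : α × ℕ) : 0 < blockSize (order a.1) := blockSize_pos _
  refine .forall_lt .order (.imp (.eq (.div .snd hk hk0) hq.comp_fst) (.imp (.le ?_ ?_) ?_))
  · exact polyTime_rank hk hx.comp_fst hj.comp_fst .snd hk0
  · exact polyTime_rank hk hx.comp_fst hj.comp_fst hu.comp_fst hk0
  · exact polyDec_adjNat (α := α × ℕ) .snd hv.comp_fst

theorem polyDec_coverable (hq : PolyTime q) (hc : PolyTime c) :
    PolyDec fun a => Coverable (graph a) (blockSize (order a)) (q a) (c a) := by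
  simp only [coverable_iff]
  refine .exists_lt polyTime_blockSize_pow (.forall_lt PolyTime.order.comp_fst (.imp
    (.eq (.div .snd polyTime_blockSize.comp_fst.comp_fst fun _ => blockSize_pos _)
      hq.comp_fst.comp_fst)
    (.forall_lt PolyTime.order.comp_fst.comp_fst (.imp ?_ (.exists_lt
      hc.comp_fst.comp_fst.comp_fst ?_)))))
  · exact polyDec_adjNat (α := ((α × ℕ) × ℕ) × ℕ) PolyTime.snd.comp_fst .snd
  · exact polyDec_forall_rank_le (α := (((α × ℕ) × ℕ) × ℕ) × ℕ)
      hq.comp_fst.comp_fst.comp_fst.comp_fst PolyTime.snd.comp_fst.comp_fst.comp_fst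
      .snd PolyTime.snd.comp_fst.comp_fst PolyTime.snd.comp_fst

theorem polyTime_chainCoverEstimate :
    PolyTime fun a : Input => chainCoverEstimate a.2 :=
  .sum .order (.sInf (P := fun (a : Input × ℕ) i => Coverable (graph a) (blockSize (order a)) a.2 i)
    polyTime_blockSize.comp_fst
    (polyDec_coverable (α := (Input × ℕ) × ℕ) PolyTime.snd.comp_fst .snd)
    fun _ => coverable_self _ (blockSize_pos _) _)

end Algorithm
end ChainCover

theorem mainTheorem3 :
    ∃ (p : RAM.Prog) (T : Polynomial ℕ),
      ∀ (n : ℕ) (G : SimpleGraph (Fin n)), G.IsBipartite →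
        ∃ (t : ℕ) (s : RAM.State),
          RAM.Exec p (RAM.initState G) t s ∧ t ≤ T.eval n ∧
            (3 ≤ n →
              G.chainCoverNumber ≤ s.output ∧
                s.output ≤ chainCoverFactor n * G.chainCoverNumber) := by
  obtain ⟨p, T, hp⟩ := ChainCover.polyTime_chainCoverEstimate.exists_prog
  refine ⟨p, T, fun n G hG => ?_⟩
  obtain ⟨t, s, hexec, ht, houtput⟩ := hp n G
  refine ⟨t, s, hexec, ht, fun hn => ?_⟩
  rw [houtput]
  exact ⟨ChainCover.chainCoverNumber_le_chainCoverEstimate hG,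
    ChainCover.chainCoverEstimate_le hG hn⟩
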